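/- Let $\mathbb D=\{z\in\mathbb C:|z|<1\}$, let $dA$ be the area measure on $\mathbb D$ normalized so that $A(\mathbb D)=1$, and write $|E|=A(E)$. For measurable $f:\mathbb D\to\mathbb C$ put $$\|f\|_{L^{p,1}(\mathbb D)}=p\int_0^\infty |\{z\in\mathbb D:|f(z)|>\lambda\}|^{1/p}\,d\lambda\quad(1\le p<\infty),\qquad \|f\|_{L^{1,\infty}(\mathbb D)}=\sup_{\lambda>0}\lambda\,|\{z\in\mathbb D:|f(z)|>\lambda\}|,$$ and let $L^{p,1}(\mathbb D)$ and $L^{1,\infty}(\mathbb D)$ be the spaces of measurable functions for which the respective quantity is finite. **Theorem.** Let $1<t<3/2$. The hypersingular Bergman projection $$K_{2t}f(z)=\int_{\mathbb D}\frac{f(w)}{(1-z\overline w)^{2t}}\,dA(w),\qquad z\in\mathbb D,$$ (with the principal branch of the power) is bounded from $L^{\frac1{3-2t},1}(\mathbb D)$ to $L^{1,\infty}(\mathbb D)$. That is, there is a constant $C<\infty$ depending only on $t$ such that for every $f\in L^{\frac1{3-2t},1}(\mathbb D)$ the integral defining $K_{2t}f(z)$ converges absolutely for every $z\in\mathbb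 D$, the function $K_{2t}f$ belongs to $L^{1,\infty}(\mathbb D)$, and $$\|K_{2t}f\|_{L^{1,\infty}(\mathbb D)}\le C\,\|f\|_{L^{\frac1{3-2t},1}(\mathbb D)}.$$ -/

import Mathlib

open MeasureTheory Set Metric
open scoped ENNReal NNReal ComplexConjugate

noncomputable section

namespace HypersingularBergman

/-- The normalized area measure `dA` on the unit disc `𝔻 = {|z| < 1}`, as a measure on `ℂ`
carried by `𝔻`; its total mass is `1`. -/
def discMeasure : Measure ℂ :=
  (ENNReal.ofReal Real.pi)⁻¹ • (volume : Measure ℂ).restrict (ball (0 : ℂ) 1)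

/-- The integrand `f(w) / (1 - z w̄)^{2t}` (principal branch; `Re (1 - z w̄) > 0` on `𝔻 × 𝔻`). -/
def bergmanIntegrand (t : ℝ) (f : ℂ → ℂ) (z w : ℂ) : ℂ :=
  f w / (1 - z * conj w) ^ ((2 * t : ℝ) : ℂ)

/-- The operator `K_{2t} f(z) = ∫_𝔻 f(w) / (1 - z w̄)^{2t} dA(w)`. Only its values on `𝔻` matter. -/
def bergmanK (t : ℝ) (f : ℂ → ℂ) (z : ℂ) : ℂ :=
  ∫ w, bergmanIntegrand t f z w ∂discMeasure

/-- The distribution function `λ ↦ |{z ∈ 𝔻 : |f(z)| > λ}|`. -/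
def distrib (f : ℂ → ℂ) (l : ℝ) : ℝ≥0∞ := discMeasure {z | l < ‖f z‖}

/-- `‖f‖_{L^{p,1}(𝔻)} = p ∫_0^∞ |{z ∈ 𝔻 : |f(z)| > λ}|^{1/p} dλ`, for `1 ≤ p < ∞`. -/
def lorentzOneNorm (p : ℝ) (f : ℂ → ℂ) : ℝ≥0∞ :=
  ENNReal.ofReal p * ∫⁻ l in Ioi (0 : ℝ), distrib f l ^ (1 / p)

/-- `‖f‖_{L^{q,∞}(𝔻)} = sup_{λ > 0} λ |{z ∈ 𝔻 : |f(z)| > λ}|^{1/q}`, for `1 ≤ q < ∞`. -/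
def weakNorm (q : ℝ) (f : ℂ → ℂ) : ℝ≥0∞ :=
  ⨆ (l : ℝ) (_ : 0 < l), ENNReal.ofReal l * distrib f l ^ (1 / q)

/-- `f ∈ L^{p,1}(𝔻)`. -/
def MemLorentzOne (p : ℝ) (f : ℂ → ℂ) : Prop :=
  AEStronglyMeasurable f discMeasure ∧ lorentzOneNorm p f < ∞

/-- `f ∈ L^{q,∞}(𝔻)`. -/
def MemWeak (q : ℝ) (f : ℂ → ℂ) : Prop :=
  AEStronglyMeasurable f discMeasure ∧ weakNorm q f < ∞

end HypersingularBergman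

end

/-!
The operator is in fact bounded from `L^{p,1}(𝔻)`, `p = 1 / (3 - 2t)`, to the strong space
`L¹(𝔻)`, and the weak bound follows by Chebyshev's inequality.

By Tonelli, `‖K_{2t} f‖₁ ≤ ∫ |f(w)| G(w) dA(w)` with `G(w) = ∫ |1 - z w̄|^{-2t} dA(z)`. The set
`{z ∈ 𝔻 : |1 - z w̄| < r}` has measure at most `4 r²` and `|1 - z w̄| ≥ 1 - |w|`, so the layer cake
formula gives `G(w) ≲ (1 - |w|)^{-b}` with `b = 2t - 2 ∈ (0, 1)` (`lintegral_kernel_le`). The function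
`1 / (1 - |w|)` is in weak `L¹`, so by Kolmogorov's inequality (`setLIntegral_rpow_le_of_weak`) the
measure `(1 - |w|)^{-b} dA` of a set `E` is `≲ |E|^{1 - b}`, and `1 - b = 1 / p`. Applying the layer
cake formula to `|f|` and this weighted measure yields
`∫ |f| (1 - |w|)^{-b} dA ≲ ∫_0^∞ |{|f| > λ}|^{1/p} dλ` (`lintegral_mul_weight_le`). In other words,
`G` lies in `L^{p',∞}`, the dual of `L^{p,1}`.
-/

noncomputable section

namespace HypersingularBergman

/-! ### Layer cake estimates -/

lemma lintegral_Ioc_rpow {r M : ℝ} (hr : -1 < r) (hM : 0 ≤ M) :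
    ∫⁻ s in Ioc 0 M, ENNReal.ofReal (s ^ r) = ENNReal.ofReal (M ^ (r + 1) / (r + 1)) := by
  rw [← ofReal_integral_eq_lintegral_ofReal, ← intervalIntegral.integral_of_le hM,
    integral_rpow (Or.inl hr), Real.zero_rpow (by linarith), sub_zero]
  · exact (intervalIntegrable_iff_integrableOn_Ioc_of_le hM).1
      (intervalIntegral.intervalIntegrable_rpow' hr)
  · filter_upwards [ae_restrict_mem measurableSet_Ioc] with s hs
    exact Real.rpow_nonneg hs.1.le r

lemma lintegral_Ioi_rpow {r c : ℝ} (hr : r < -1) (hc : 0 < c) :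
    ∫⁻ s in Ioi c, ENNReal.ofReal (s ^ r) = ENNReal.ofReal (-c ^ (r + 1) / (r + 1)) := by
  rw [← ofReal_integral_eq_lintegral_ofReal, integral_Ioi_rpow_of_lt hr hc]
  · exact integrableOn_Ioi_rpow_of_lt hr hc
  · filter_upwards [ae_restrict_mem measurableSet_Ioi] with s hs
    exact Real.rpow_nonneg (hc.trans hs).le r

variable {α : Type*} [MeasurableSpace α]

/-- The `L^q` integral, `q > 2`, of a bounded function in weak `L²`. -/
lemma lintegral_rpow_le_of_weak_two {μ : Measure α} {f : α → ℝ} (hf0 : 0 ≤ᵐ[μ] f)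
    (hf : AEMeasurable f μ) {A M q : ℝ} (hA : 0 ≤ A) (hM : 0 ≤ M) (hq : 2 < q)
    (hfM : ∀ᵐ x ∂μ, f x ≤ M)
    (hw : ∀ s, 0 < s → μ {x | s < f x} ≤ ENNReal.ofReal (A * s ^ (-2 : ℝ))) :
    ∫⁻ x, ENNReal.ofReal (f x ^ q) ∂μ ≤ ENNReal.ofReal (q * A / (q - 2) * M ^ (q - 2)) := by
  rw [lintegral_rpow_eq_lintegral_meas_lt_mul μ hf0 hf (by linarith)]
  have hzero : ∀ s, M < s → μ {x | s < f x} = 0 := by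
    intro s hs
    have : ∀ᵐ x ∂μ, ¬ s < f x := hfM.mono fun x hx => by linarith
    simpa [ae_iff] using this
  have hle : ∫⁻ s in Ioi (0 : ℝ), μ {x | s < f x} * ENNReal.ofReal (s ^ (q - 1)) ≤
      ∫⁻ s in Ioc 0 M, ENNReal.ofReal A * ENNReal.ofReal (s ^ (q - 3)) := by
    rw [← lintegral_indicator measurableSet_Ioi, ← lintegral_indicator measurableSet_Ioc]
    refine lintegral_mono fun s => ?_
    by_cases hs : 0 < s
    · rw [indicator_of_mem (mem_Ioi.2 hs)]
      by_cases hsM : s ≤ M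
      · rw [indicator_of_mem (mem_Ioc.2 ⟨hs, hsM⟩)]
        refine (mul_le_mul_left (hw s hs) _).trans_eq ?_
        rw [ENNReal.ofReal_mul hA, mul_assoc, ← ENNReal.ofReal_mul (Real.rpow_nonneg hs.le _),
          ← Real.rpow_add hs]
        ring_nf
      · rw [hzero s (not_le.1 hsM), zero_mul]
        exact zero_le
    · rw [indicator_of_notMem (by simpa using hs)]
      exact zero_le
  refine (mul_le_mul_right hle _).trans_eq ?_
  rw [lintegral_const_mul' _ _ ENNReal.ofReal_ne_top, lintegral_Ioc_rpow (by linarith) hM,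
    ← ENNReal.ofReal_mul hA, ← ENNReal.ofReal_mul (by linarith)]
  ring_nf

/-- Kolmogorov's inequality: the integral over `E` of the power `b < 1` of a weak `L¹` function is
controlled by `μ E ^ (1 - b)`. -/
lemma setLIntegral_rpow_le_of_weak {μ : Measure α} [IsFiniteMeasure μ] {f : α → ℝ}
    (hf0 : 0 ≤ᵐ[μ] f) (hf : AEMeasurable f μ) {A b : ℝ} (hA : 0 ≤ A) (hb0 : 0 < b) (hb1 : b < 1)
    (hw : ∀ s, 0 < s → μ {x | s < f x} ≤ ENNReal.ofReal (A * s ^ (-1 : ℝ))) (E : Set α) :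
    ∫⁻ x in E, ENNReal.ofReal (f x ^ b) ∂μ ≤
      ENNReal.ofReal (1 + b * A / (1 - b)) * μ E ^ (1 - b) := by
  rcases eq_or_ne (μ E) 0 with hE | hE
  · exact (setLIntegral_measure_zero E _ hE).trans_le zero_le
  set m : ℝ := (μ E).toReal with hm
  have hEm : μ E = ENNReal.ofReal m := (ENNReal.ofReal_toReal (measure_ne_top μ E)).symm
  have hm0 : 0 < m := ENNReal.toReal_pos hE (measure_ne_top μ E)
  rw [lintegral_rpow_eq_lintegral_meas_lt_mul _ (ae_restrict_of_ae hf0) hf.restrict hb0]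
  -- The two bounds `μ E` and `A / s` for the distribution function balance at `s = 1 / μ E`.
  have hS : 0 < m⁻¹ := inv_pos.2 hm0
  have h1 : ∫⁻ s in Ioc (0 : ℝ) m⁻¹,
      μ.restrict E {x | s < f x} * ENNReal.ofReal (s ^ (b - 1)) ≤
      ENNReal.ofReal (m ^ (1 - b) / b) := by
    refine (lintegral_mono (g := fun s => ENNReal.ofReal m * ENNReal.ofReal (s ^ (b - 1)))
      fun s => mul_le_mul_left ?_ _).trans_eq ?_
    · rw [← hEm, ← Measure.restrict_apply_univ E]
      exact measure_mono (μ := μ.restrict E) (subset_univ {x | s < f x})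
    · rw [lintegral_const_mul' _ _ ENNReal.ofReal_ne_top, lintegral_Ioc_rpow (by linarith) hS.le,
        ← ENNReal.ofReal_mul hm0.le, Real.inv_rpow hm0.le, Real.rpow_sub hm0, Real.rpow_one]
      congr 1
      ring_nf
  have h2 : ∫⁻ s in Ioi m⁻¹,
      μ.restrict E {x | s < f x} * ENNReal.ofReal (s ^ (b - 1)) ≤
      ENNReal.ofReal (A / (1 - b) * m ^ (1 - b)) := by
    refine (setLIntegral_mono' (g := fun s => ENNReal.ofReal A * ENNReal.ofReal (s ^ (b - 2)))
      measurableSet_Ioi fun s hs => ?_).trans_eq ?_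
    · have hs0 : 0 < s := hS.trans hs
      refine (mul_le_mul_left ((Measure.restrict_apply_le _ _).trans (hw s hs0)) _).trans_eq ?_
      rw [ENNReal.ofReal_mul hA, mul_assoc, ← ENNReal.ofReal_mul (Real.rpow_nonneg hs0.le _),
        ← Real.rpow_add hs0]
      ring_nf
    · rw [lintegral_const_mul' _ _ ENNReal.ofReal_ne_top, lintegral_Ioi_rpow (by linarith) hS,
        ← ENNReal.ofReal_mul hA, Real.inv_rpow hm0.le, ← Real.rpow_neg hm0.le]
      have e : -(b - 2 + 1) = 1 - b := by ring
      have e' : b - 2 + 1 = -(1 - b) := by ring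
      rw [e, e', neg_div_neg_eq]
      congr 1
      ring
  rw [← Ioc_union_Ioi_eq_Ioi hS.le]
  refine (mul_le_mul_right ((lintegral_union_le _ _ _).trans (add_le_add h1 h2)) _).trans_eq ?_
  have hb1' : 0 < 1 - b := by linarith
  rw [hEm, ENNReal.ofReal_rpow_of_pos hm0, ← ENNReal.ofReal_add (by positivity) (by positivity),
    ← ENNReal.ofReal_mul hb0.le, ← ENNReal.ofReal_mul (by positivity)]
  congr 1
  field_simp

/-! ### The normalized area measure -/

lemma coe_nnreal_pi : (NNReal.pi : ℝ≥0∞) = ENNReal.ofReal Real.pi := by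
  rw [← NNReal.coe_real_pi, ENNReal.ofReal_coe_nnreal]

instance : IsProbabilityMeasure discMeasure := by
  constructor
  rw [discMeasure, Measure.smul_apply, Measure.restrict_apply_univ, Complex.volume_ball]
  rw [coe_nnreal_pi, smul_eq_mul, ENNReal.ofReal_one, one_pow, one_mul]
  exact ENNReal.inv_mul_cancel (by simp [Real.pi_pos]) ENNReal.ofReal_ne_top

lemma ae_mem_ball : ∀ᵐ z ∂discMeasure, z ∈ ball (0 : ℂ) 1 :=
  Measure.ae_smul_measure (ae_restrict_mem measurableSet_ball) _

lemma discMeasure_apply_ball_le (c : ℂ) {r : ℝ} (hr : 0 ≤ r) :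
    discMeasure (ball c r) ≤ ENNReal.ofReal (r ^ 2) := by
  rw [discMeasure, Measure.smul_apply, smul_eq_mul]
  refine (mul_le_mul_right (Measure.restrict_apply_le _ _) _).trans_eq ?_
  rw [Complex.volume_ball, coe_nnreal_pi, mul_comm, mul_assoc,
    ENNReal.mul_inv_cancel (by simp [Real.pi_pos]) ENNReal.ofReal_ne_top, mul_one,
    ENNReal.ofReal_pow hr]

lemma discMeasure_apply_closedBall_zero {r : ℝ} (hr : 0 ≤ r) (hr1 : r < 1) :
    discMeasure (closedBall 0 r) = ENNReal.ofReal (r ^ 2) := by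
  rw [discMeasure, Measure.smul_apply, smul_eq_mul,
    Measure.restrict_apply measurableSet_closedBall,
    inter_eq_left.2 (closedBall_subset_ball hr1), Complex.volume_closedBall,
    coe_nnreal_pi, mul_comm, mul_assoc, ENNReal.mul_inv_cancel (by simp [Real.pi_pos]) ENNReal.ofReal_ne_top, mul_one,
    ENNReal.ofReal_pow hr]

/-- `1 / (1 - |w|)` is in weak `L¹`. -/
lemma discMeasure_lt_inv_one_sub_norm_le {s : ℝ} (hs : 0 < s) :
    discMeasure {w | s < (1 - ‖w‖)⁻¹} ≤ ENNReal.ofReal (2 * s ^ (-1 : ℝ)) := by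
  rw [Real.rpow_neg_one]
  rcases le_or_gt s 1 with h1 | h1
  · refine prob_le_one.trans ?_
    rw [← ENNReal.ofReal_one]
    refine ENNReal.ofReal_le_ofReal ?_
    have := (one_le_inv₀ hs).2 h1
    linarith
  · have hs1 : s⁻¹ < 1 := inv_lt_one_of_one_lt₀ h1
    have hs0 : 0 < s⁻¹ := inv_pos.2 hs
    calc discMeasure {w | s < (1 - ‖w‖)⁻¹} ≤ discMeasure (closedBall 0 (1 - s⁻¹))ᶜ := by
          refine measure_mono fun w hw => ?_
          have hw : s < (1 - ‖w‖)⁻¹ := hw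
          have hpos : 0 < 1 - ‖w‖ := inv_pos.1 (hs.trans hw)
          have := (lt_inv_comm₀ hs hpos).1 hw
          simp only [mem_compl_iff, mem_closedBall, dist_zero_right, not_le]
          linarith
      _ = 1 - ENNReal.ofReal ((1 - s⁻¹) ^ 2) := by
          rw [prob_compl_eq_one_sub measurableSet_closedBall,
            discMeasure_apply_closedBall_zero (by linarith) (by linarith)]
      _ ≤ ENNReal.ofReal (2 * s⁻¹) := by
          rw [← ENNReal.ofReal_one, ← ENNReal.ofReal_sub _ (sq_nonneg _)]
          refine ENNReal.ofReal_le_ofReal ?_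
          nlinarith

/-! ### The kernel -/

lemma one_sub_norm_le_norm_one_sub {z : ℂ} (hz : ‖z‖ ≤ 1) (w : ℂ) :
    1 - ‖w‖ ≤ ‖1 - z * conj w‖ := by
  have h := norm_sub_norm_le (1 : ℂ) (z * conj w)
  rw [norm_one, norm_mul, Complex.norm_conj] at h
  nlinarith [norm_nonneg w, norm_nonneg z]

/-- `z ↦ 1 / |1 - z w̄|` is in weak `L²`, uniformly in `w`. -/
lemma discMeasure_lt_inv_norm_one_sub_le {w : ℂ} {s : ℝ} (hs : 0 < s) :
    discMeasure {z | s < ‖1 - z * conj w‖⁻¹} ≤ ENNReal.ofReal (4 * s ^ (-2 : ℝ)) := by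
  have e : s ^ (-2 : ℝ) = s⁻¹ ^ 2 := by
    rw [Real.rpow_neg hs.le, inv_pow]
    norm_cast
  rw [e]
  rcases le_or_gt s 2 with h2 | h2
  · refine prob_le_one.trans ?_
    rw [← ENNReal.ofReal_one]
    refine ENNReal.ofReal_le_ofReal ?_
    have := inv_anti₀ hs h2
    nlinarith
  have hs0 : 0 < s⁻¹ := inv_pos.2 hs
  have hs2 : s⁻¹ < 2⁻¹ := inv_strictAnti₀ two_pos h2
  have key : ∀ z : ℂ, s < ‖1 - z * conj w‖⁻¹ → ‖1 - z * conj w‖ < s⁻¹ := fun z hz =>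
    (lt_inv_comm₀ hs (inv_pos.1 (hs.trans hz))).1 hz
  rcases le_or_gt ‖w‖ (1 / 2) with hw | hw
  · -- For `|w| ≤ 1 / 2` the set misses the disc.
    have : discMeasure {z | s < ‖1 - z * conj w‖⁻¹} = 0 := by
      have h : ∀ᵐ z ∂discMeasure, ¬ s < ‖1 - z * conj w‖⁻¹ := by
        filter_upwards [ae_mem_ball] with z hz h
        have := one_sub_norm_le_norm_one_sub (mem_ball_zero_iff.1 hz).le w
        have := key z h
        norm_num at hs2 hw
        linarith
      simpa [ae_iff] using h
    rw [this]
    exact zero_le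
  · -- For `|w| > 1 / 2` the set lies in the ball of radius `2 / s` about `1 / w̄`.
    have hw0 : conj w ≠ 0 := by
      rw [← norm_ne_zero_iff, Complex.norm_conj]
      linarith
    refine (measure_mono (t := ball (conj w)⁻¹ (2 * s⁻¹)) fun z hz => ?_).trans
      ((discMeasure_apply_ball_le _ (by positivity)).trans_eq (by ring_nf))
    have h := key z hz
    rw [mem_ball, dist_eq_norm]
    have e : 1 - z * conj w = -((z - (conj w)⁻¹) * conj w) := by
      field_simp
      ring
    rw [e, norm_neg, norm_mul, Complex.norm_conj] at h
    nlinarith [norm_nonneg (z - (conj w)⁻¹)]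

/-- The integral of the absolute value of the kernel in the variable `z`. -/
lemma lintegral_kernel_le {q : ℝ} (hq : 2 < q) {w : ℂ} (hw : w ∈ ball (0 : ℂ) 1) :
    ∫⁻ z, ENNReal.ofReal (‖1 - z * conj w‖⁻¹ ^ q) ∂discMeasure ≤
      ENNReal.ofReal (q * 4 / (q - 2)) * ENNReal.ofReal ((1 - ‖w‖)⁻¹ ^ (q - 2)) := by
  have hw1 : 0 < 1 - ‖w‖ := by
    rw [mem_ball_zero_iff] at hw
    linarith
  have hq2 : 0 < q - 2 := by linarith
  rw [← ENNReal.ofReal_mul (by positivity)]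
  refine lintegral_rpow_le_of_weak_two (Filter.Eventually.of_forall fun z => by positivity)
    (by fun_prop) (by norm_num) (inv_nonneg.2 hw1.le) hq ?_
    fun s hs => discMeasure_lt_inv_norm_one_sub_le hs
  filter_upwards [ae_mem_ball] with z hz
  exact inv_anti₀ hw1 (one_sub_norm_le_norm_one_sub (mem_ball_zero_iff.1 hz).le w)

/-! ### The Lorentz norm and the weight -/

/-- Duality between `L^{p,1}` and the weight `(1 - |w|)^{-b}` in `L^{p',∞}`, where
`1 / p = 1 - b`. -/
lemma lintegral_mul_weight_le {b : ℝ} (hb0 : 0 < b) (hb1 : b < 1) {f : ℂ → ℂ}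
    (hf : AEStronglyMeasurable f discMeasure) :
    ∫⁻ w, ENNReal.ofReal ((1 - ‖w‖)⁻¹ ^ b) * ‖f w‖ₑ ∂discMeasure ≤
      ENNReal.ofReal (1 + b * 2 / (1 - b)) *
        ∫⁻ l in Ioi (0 : ℝ), distrib f l ^ (1 - b) := by
  have hg : Measurable fun w : ℂ => ENNReal.ofReal ((1 - ‖w‖)⁻¹ ^ b) := by fun_prop
  set ν := discMeasure.withDensity fun w : ℂ => ENNReal.ofReal ((1 - ‖w‖)⁻¹ ^ b) with hν
  have hac : ν ≪ discMeasure := withDensity_absolutelyContinuous _ _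
  have h1 : ∫⁻ w, ENNReal.ofReal ((1 - ‖w‖)⁻¹ ^ b) * ‖f w‖ₑ ∂discMeasure =
      ∫⁻ w, ENNReal.ofReal ‖f w‖ ∂ν := by
    rw [hν, lintegral_withDensity_eq_lintegral_mul₀ hg.aemeasurable
      (hf.norm.aemeasurable.ennreal_ofReal)]
    simp only [Pi.mul_apply, ofReal_norm]
  rw [h1, lintegral_eq_lintegral_meas_lt ν (Filter.Eventually.of_forall fun _ => norm_nonneg _)
    (hf.norm.aemeasurable.mono_ac hac), ← lintegral_const_mul' _ _ ENNReal.ofReal_ne_top]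
  refine lintegral_mono fun l => ?_
  rw [hν, withDensity_apply']
  refine setLIntegral_rpow_le_of_weak ?_ (by fun_prop) zero_le_two hb0 hb1
    (fun s hs => discMeasure_lt_inv_one_sub_norm_le hs) _
  filter_upwards [ae_mem_ball] with w hw
  rw [mem_ball_zero_iff] at hw
  exact inv_nonneg.2 (by linarith)

/-- Membership in `L^{p,1}` gives integrability, since the weight `(1 - |w|)^{-b}` is at least
`1` on the disc. -/
lemma integrable_of_lintegral_distrib_lt_top {b : ℝ} (hb0 : 0 < b) (hb1 : b < 1) {f : ℂ → ℂ}
    (hf : AEStronglyMeasurable f discMeasure)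
    (hfin : ∫⁻ l in Ioi (0 : ℝ), distrib f l ^ (1 - b) < ∞) :
    Integrable f discMeasure := by
  refine ⟨hf, lt_of_le_of_lt (lintegral_mono_ae ?_) ((lintegral_mul_weight_le hb0 hb1 hf).trans_lt
    (ENNReal.mul_lt_top ENNReal.ofReal_lt_top hfin))⟩
  filter_upwards [ae_mem_ball] with w hw
  rw [mem_ball_zero_iff] at hw
  refine le_mul_of_one_le_left zero_le ?_
  rw [← ENNReal.ofReal_one]
  exact ENNReal.ofReal_le_ofReal
    (Real.one_le_rpow ((one_le_inv₀ (by linarith)).2 (by linarith [norm_nonneg w])) hb0.le)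

/-! ### The operator -/

lemma enorm_bergmanIntegrand (t : ℝ) (f : ℂ → ℂ) (z w : ℂ) :
    ‖bergmanIntegrand t f z w‖ₑ = ‖f w‖ₑ * ENNReal.ofReal (‖1 - z * conj w‖⁻¹ ^ (2 * t)) := by
  rw [bergmanIntegrand, div_eq_mul_inv, enorm_mul, ← ofReal_norm (_⁻¹), norm_inv,
    Complex.norm_cpow_real, Real.inv_rpow (norm_nonneg _)]

lemma measurable_kernel (t : ℝ) :
    Measurable fun x : ℂ × ℂ => (1 - x.1 * conj x.2) ^ ((2 * t : ℝ) : ℂ) := by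
  have : Measurable fun w : ℂ => conj w := Complex.continuous_conj.measurable
  fun_prop

lemma integrable_bergmanIntegrand {t : ℝ} (ht : 0 < t) {f : ℂ → ℂ} (hf : Integrable f discMeasure)
    {z : ℂ} (hz : z ∈ ball (0 : ℂ) 1) : Integrable (bergmanIntegrand t f z) discMeasure := by
  rw [mem_ball_zero_iff] at hz
  have hz1 : 0 < 1 - ‖z‖ := by linarith
  have hm : Measurable fun w : ℂ => ((1 - z * conj w) ^ ((2 * t : ℝ) : ℂ))⁻¹ :=
    ((measurable_kernel t).comp measurable_prodMk_left).inv
  refine hf.mul_bdd (c := (1 - ‖z‖)⁻¹ ^ (2 * t)) hm.aestronglyMeasurable ?_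
  filter_upwards [ae_mem_ball] with w hw
  rw [mem_ball_zero_iff] at hw
  rw [norm_inv, Complex.norm_cpow_real, ← Real.inv_rpow (norm_nonneg _)]
  have h := one_sub_norm_le_norm_one_sub hw.le z
  have e : ‖1 - z * conj w‖ = ‖1 - w * conj z‖ := by
    rw [← Complex.norm_conj]
    simp [mul_comm]
  rw [e]
  exact Real.rpow_le_rpow (by positivity) (inv_anti₀ hz1 h) (by linarith)

lemma aestronglyMeasurable_bergmanIntegrand (t : ℝ) {f : ℂ → ℂ}
    (hf : AEStronglyMeasurable f discMeasure) :
    AEStronglyMeasurable (fun x : ℂ × ℂ => bergmanIntegrand t f x.1 x.2)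
      (discMeasure.prod discMeasure) :=
  hf.comp_snd.mul (measurable_kernel t).inv.aestronglyMeasurable

lemma aestronglyMeasurable_bergmanK (t : ℝ) {f : ℂ → ℂ}
    (hf : AEStronglyMeasurable f discMeasure) :
    AEStronglyMeasurable (bergmanK t f) discMeasure :=
  (aestronglyMeasurable_bergmanIntegrand t hf).integral_prod_right'

/-- The strong `L¹` bound. -/
lemma lintegral_enorm_bergmanK_le {t : ℝ} (ht₁ : 1 < t) (ht₂ : t < 3 / 2) {f : ℂ → ℂ}
    (hf : AEStronglyMeasurable f discMeasure) :
    ∫⁻ z, ‖bergmanK t f z‖ₑ ∂discMeasure ≤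
      ENNReal.ofReal (2 * t * 4 / (2 * t - 2)) *
        (ENNReal.ofReal (1 + (2 * t - 2) * 2 / (1 - (2 * t - 2))) *
          ∫⁻ l in Ioi (0 : ℝ), distrib f l ^ (1 - (2 * t - 2))) := by
  calc ∫⁻ z, ‖bergmanK t f z‖ₑ ∂discMeasure
      ≤ ∫⁻ z, ∫⁻ w, ‖bergmanIntegrand t f z w‖ₑ ∂discMeasure ∂discMeasure :=
        lintegral_mono fun z => enorm_integral_le_lintegral_enorm _
    _ = ∫⁻ w, ∫⁻ z, ‖bergmanIntegrand t f z w‖ₑ ∂discMeasure ∂discMeasure :=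
        lintegral_lintegral_swap (aestronglyMeasurable_bergmanIntegrand t hf).enorm
    _ ≤ ∫⁻ w, ENNReal.ofReal (2 * t * 4 / (2 * t - 2)) *
          (ENNReal.ofReal ((1 - ‖w‖)⁻¹ ^ (2 * t - 2)) * ‖f w‖ₑ) ∂discMeasure := by
        refine lintegral_mono_ae ?_
        filter_upwards [ae_mem_ball] with w hw
        simp_rw [enorm_bergmanIntegrand]
        rw [lintegral_const_mul' _ _ enorm_ne_top, ← mul_assoc, mul_comm]
        exact mul_le_mul_left (lintegral_kernel_le (by linarith) hw) _
    _ ≤ _ := by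
        rw [lintegral_const_mul' _ _ ENNReal.ofReal_ne_top]
        exact mul_le_mul_right (lintegral_mul_weight_le (by linarith) (by linarith) hf) _

lemma weakNorm_one_le_lintegral {g : ℂ → ℂ} (hg : AEStronglyMeasurable g discMeasure) :
    weakNorm 1 g ≤ ∫⁻ z, ‖g z‖ₑ ∂discMeasure := by
  refine iSup₂_le fun l _ => ?_
  rw [div_one, ENNReal.rpow_one]
  refine le_trans (mul_le_mul_right (measure_mono fun z hz => ?_) _)
    (mul_meas_ge_le_lintegral₀ hg.enorm (ENNReal.ofReal l))
  have hz : l < ‖g z‖ := hz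
  change ENNReal.ofReal l ≤ ‖g z‖ₑ
  rw [← ofReal_norm]
  exact ENNReal.ofReal_le_ofReal hz.le

end HypersingularBergman

end

open HypersingularBergman in
theorem mainTheorem2 (t : ℝ) (ht₁ : 1 < t) (ht₂ : t < 3 / 2) :
    ∃ C : ℝ≥0, ∀ f : ℂ → ℂ, HypersingularBergman.MemLorentzOne (1 / (3 - 2 * t)) f →
      (∀ z ∈ ball (0 : ℂ) 1,
        Integrable (HypersingularBergman.bergmanIntegrand t f z)
          HypersingularBergman.discMeasure) ∧
      HypersingularBergman.MemWeak 1 (HypersingularBergman.bergmanK t f) ∧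
      HypersingularBergman.weakNorm 1 (HypersingularBergman.bergmanK t f) ≤
        (C : ℝ≥0∞) * HypersingularBergman.lorentzOneNorm (1 / (3 - 2 * t)) f := by
  set A : ℝ := 2 * t * 4 / (2 * t - 2)
  set B : ℝ := 1 + (2 * t - 2) * 2 / (1 - (2 * t - 2))
  refine ⟨A.toNNReal * B.toNNReal, fun f hf => ?_⟩
  obtain ⟨hm, hfin⟩ := hf
  have hp : 1 ≤ 1 / (3 - 2 * t) := (one_le_div (by linarith)).2 (by linarith)
  have hexp : 1 / (1 / (3 - 2 * t)) = 1 - (2 * t - 2) := by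
    rw [one_div_one_div]
    ring
  -- The factor `p` in the Lorentz norm is at least `1`.
  have hI : ∫⁻ l in Ioi (0 : ℝ), distrib f l ^ (1 - (2 * t - 2)) ≤
      lorentzOneNorm (1 / (3 - 2 * t)) f := by
    rw [lorentzOneNorm, hexp]
    refine le_mul_of_one_le_left zero_le ?_
    rw [← ENNReal.ofReal_one]
    exact ENNReal.ofReal_le_ofReal hp
  have hK := aestronglyMeasurable_bergmanK t hm
  have hbound : weakNorm 1 (bergmanK t f) ≤
      ((A.toNNReal * B.toNNReal : ℝ≥0) : ℝ≥0∞) * lorentzOneNorm (1 / (3 - 2 * t)) f := by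
    refine (weakNorm_one_le_lintegral hK).trans
      ((lintegral_enorm_bergmanK_le ht₁ ht₂ hm).trans ?_)
    rw [ENNReal.coe_mul, mul_assoc (A.toNNReal : ℝ≥0∞)]
    exact mul_le_mul_right (mul_le_mul_right hI _) _
  refine ⟨fun z hz => ?_, ⟨hK, hbound.trans_lt (ENNReal.mul_lt_top ENNReal.coe_lt_top hfin)⟩,
    hbound⟩
  exact integrable_bergmanIntegrand (by linarith)
    (integrable_of_lintegral_distrib_lt_top (b := 2 * t - 2) (by linarith) (by linarith) hm
      (hI.trans_lt hfin)) hz
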